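/- All graphs are finite, simple and connected, and all embeddings of graphs in closed surfaces are cellular. An \emph{Apollonian network} is a planar graph obtained from the complete graph $K_4$ by repeatedly (possibly zero times) choosing a triangular face $(a,b,c)$ of the embedding on the sphere and adding a new vertex adjacent to exactly $a$, $b$ and $c$. An \emph{Apollonian dual} is a graph isomorphic to the dual graph of an Apollonian network embedded on the sphere. An embedding of a graph $G$ in a closed surface, given combinatorially by a rotation system (a cyclic ordering of the edges at each vertex) and a signature $\lambda\colon E(G)\to\{1,-1\}$, is \emph{strong} if every facial walk is a cycle of $G$. \textbf{Theorem.} Let $G$ be an Apollonian dual. Then for every integer $g\ge 1$, $G$ has no strong embedding on the orientable surface of genus $g$. -/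

import Mathlib

universe u

/-- A cellular embedding of a graph `G` in a closed surface, described as usual by a rotation
system (a cyclic ordering of the darts leaving each vertex) and a signature
(the twisted edges are those of sign `-1`). -/
structure CellularEmbedding {V : Type u} (G : SimpleGraph V) where
  /-- the successor of a dart in the cyclic ordering around its initial vertex -/
  rot : Equiv.Perm G.Dart
  rot_fst : ∀ d : G.Dart, (rot d).fst = d.fst
  /-- the darts leaving a vertex form a single cycle -/
  rot_sameCycle : ∀ d d' : G.Dart, d.fst = d'.fst → rot.SameCycle d d'
  /-- the signature -/
  sign : G.edgeSet → ℤˣ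

namespace CellularEmbedding

variable {V : Type u} {G : SimpleGraph V}

/-- A state of the face traversal: the dart about to be traversed, and whether the rotations are
currently read forwards (`1`) or backwards (`-1`). -/
abbrev Flag (G : SimpleGraph V) : Type u := G.Dart × ℤˣ

/-- The sign of the edge underlying a dart. -/
def dartSign (M : CellularEmbedding G) (d : G.Dart) : ℤˣ := M.sign ⟨d.edge, d.edge_mem⟩

/-- One step of the face traversal: traverse the dart, switch the direction of reading if its edge
is twisted, and leave by the dart next to the one just traversed. -/
def step (M : CellularEmbedding G) (x : Flag G) : Flag G :=
  ((M.rot ^ ((x.2 * M.dartSign x.1 : ℤˣ) : ℤ)) x.1.symm, x.2 * M.dartSign x.1)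

/-- The same side of the same edge, traversed in the opposite direction. -/
def reverse (M : CellularEmbedding G) (x : Flag G) : Flag G :=
  (x.1.symm, -(x.2 * M.dartSign x.1))

/-- The faces (cells) of the embedding: the orbits of the face traversal, where a facial walk is
identified with its reverse. -/
def Face (M : CellularEmbedding G) : Type u :=
  Quot fun x y : Flag G => y = M.step x ∨ y = M.reverse x

/-- The face on whose boundary a flag lies. -/
def face (M : CellularEmbedding G) (x : Flag G) : M.Face := Quot.mk _ x

/-- The closed facial walk starting with the flag `x`, as the list of its darts. -/
noncomputable def facialWalk (M : CellularEmbedding G) (x : Flag G) : List G.Dart :=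
  (List.range (Function.minimalPeriod M.step x)).map fun i => (M.step^[i] x).1

/-- The embedding is strong: every facial walk is a cycle of the graph. -/
def IsStrong (M : CellularEmbedding G) : Prop :=
  ∀ x : Flag G, ∃ (v : V) (c : G.Walk v v), c.IsCycle ∧ c.darts = M.facialWalk x

/-- The surface is orientable: the rotations at some of the vertices can be reversed so that no
twisted edge remains. -/
def IsOrientable (M : CellularEmbedding G) : Prop :=
  ∃ ε : V → ℤˣ, ∀ d : G.Dart, M.dartSign d = ε d.fst * ε d.snd

/-- The Euler characteristic `|V| - |E| + |F|` of the surface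
(for a finite connected graph with at least one edge). -/
noncomputable def eulerChar (M : CellularEmbedding G) : ℤ :=
  (Nat.card V : ℤ) - Nat.card G.edgeSet + Nat.card M.Face

/-- The surface is the closed orientable surface of genus `g`. -/
def OnOrientableSurface (M : CellularEmbedding G) (g : ℕ) : Prop :=
  M.IsOrientable ∧ M.eulerChar = 2 - 2 * (g : ℤ)

/-- The embedding is an embedding on the sphere. -/
def IsSpherical (M : CellularEmbedding G) : Prop := M.OnOrientableSurface 0

/-- The dual graph of an embedded graph: its vertices are the faces, and two distinct faces are
adjacent if their boundaries share an edge. -/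
def dual (M : CellularEmbedding G) : SimpleGraph M.Face where
  Adj f f' := f ≠ f' ∧ ∃ x y : Flag G, M.face x = f ∧ M.face y = f' ∧ x.1.edge = y.1.edge
  symm := ⟨fun _ _ ⟨h, x, y, hx, hy, e⟩ => ⟨h.symm, y, x, hy, hx, e.symm⟩⟩
  loopless := ⟨fun _ h => h.1 rfl⟩

/-- The triangle `(a, b, c)` bounds a face of the embedding. -/
def IsTriangularFace (M : CellularEmbedding G) (a b c : V) : Prop :=
  ∃ x : Flag G, (M.facialWalk x).map (fun d => d.fst) = [a, b, c]

end CellularEmbedding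

/-- The graph obtained from `G` by adding a new vertex `none` adjacent to exactly `a`, `b`, `c`. -/
def subdivideTriangle {V : Type u} (G : SimpleGraph V) (a b c : V) : SimpleGraph (Option V) where
  Adj
    | some v, some w => G.Adj v w
    | some v, none => v = a ∨ v = b ∨ v = c
    | none, some w => w = a ∨ w = b ∨ w = c
    | none, none => False
  symm := ⟨by
    rintro (_ | v) (_ | w) h
    · exact h
    · exact h
    · exact h
    · exact G.adj_symm h⟩
  loopless := ⟨by
    rintro (_ | v) h
    · exact h
    · exact G.irrefl h⟩

/-- Apollonian networks: the graphs obtained, up to isomorphism, from the complete graph on four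
vertices by repeatedly subdividing a triangular face of an embedding on the sphere. -/
inductive IsApollonianNetwork : {V : Type u} → SimpleGraph V → Prop
  | completeFour {V : Type u} (G : SimpleGraph V) :
      Nonempty (G ≃g (⊤ : SimpleGraph (Fin 4))) → IsApollonianNetwork G
  | subdivide {V : Type u} (G : SimpleGraph V) (M : CellularEmbedding G) (a b c : V) :
      IsApollonianNetwork G → M.IsSpherical → M.IsTriangularFace a b c →
      IsApollonianNetwork (subdivideTriangle G a b c)
  | iso {V W : Type u} (G : SimpleGraph V) (H : SimpleGraph W) :
      IsApollonianNetwork G → Nonempty (G ≃g H) → IsApollonianNetwork H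

/-- Apollonian duals: the graphs isomorphic to the dual graph of an Apollonian network
embedded on the sphere. -/
def IsApollonianDual {W : Type u} (D : SimpleGraph W) : Prop :=
  ∃ (V : Type u) (T : SimpleGraph V) (M : CellularEmbedding T),
    IsApollonianNetwork T ∧ M.IsSpherical ∧ Nonempty (D ≃g M.dual)

/-! Let D be the dual of the Apollonian network T on the sphere. Counting edges shows that T is a
triangulation, so D is cubic, and at each vertex of D (a triangle of T) a rotation is either the
spherical one or its mirror image. An orientable embedding of D is thus a choice of sign for each
triangle of T. If the embedding is strong, all signs agree (`IsTwistRigid`): the embedding is then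
the spherical one or its mirror image, it has at least as many faces as T has vertices
(`IsStrong.natCard_le_face`), and its Euler characteristic is at least 2.

Rigidity is proved by induction along the construction of T. Around a vertex of degree three the
signs agree, since otherwise a face would pass twice through one of the three triangles
(`sign_const_of_degree_three`). Hence the vertex can be deleted, its three triangles merging into
one of the same sign, and strength survives (`IsStrongTwist.deleteNone`). In `K₄` every vertex has
degree three.

The induction ranges over all abstract triangle systems, so the given spherical embedding of T need
not be compared with those used to build T. -/

/-! ### Triangle systems -/

/-- `t a b` is the third vertex of the triangle lying to the left of the dart from `a` to `b`, in a
coherently oriented system of triangles having every dart on exactly one of them. -/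
structure IsTriangleSystem {V : Type*} (G : SimpleGraph V) (t : V → V → V) : Prop where
  adj : ∀ {a b}, G.Adj a b → G.Adj b (t a b)
  cyc : ∀ {a b}, G.Adj a b → t b (t a b) = a

namespace IsTriangleSystem

variable {V : Type*} {G : SimpleGraph V} {t : V → V → V}

theorem adj' (h : IsTriangleSystem G t) {a b : V} (hab : G.Adj a b) : G.Adj (t a b) a := by
  simpa [h.cyc hab] using h.adj (h.adj hab)

theorem cyc' (h : IsTriangleSystem G t) {a b : V} (hab : G.Adj a b) : t (t a b) a = b := by
  simpa [h.cyc hab] using h.cyc (h.adj hab)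

theorem left_injective (h : IsTriangleSystem G t) {a b v : V} (ha : G.Adj a v) (hb : G.Adj b v)
    (e : t a v = t b v) : a = b := by
  rw [← h.cyc ha, e, h.cyc hb]

/-- Around a vertex of degree three the triangles follow each other cyclically. -/
theorem cyclic_of_degree_three (h : IsTriangleSystem G t) {v a b c : V}
    (hv : ∀ w, G.Adj v w ↔ w = a ∨ w = b ∨ w = c) (hab : a ≠ b) (hbc : b ≠ c) (hca : c ≠ a) :
    (t a v = b ∧ t b v = c ∧ t c v = a) ∨ (t a v = c ∧ t c v = b ∧ t b v = a) := by
  have ha : G.Adj a v := ((hv a).2 (by simp)).symm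
  have hb : G.Adj b v := ((hv b).2 (by simp)).symm
  have hc : G.Adj c v := ((hv c).2 (by simp)).symm
  have a1 := (hv _).1 (h.adj ha)
  have b1 := (hv _).1 (h.adj hb)
  have c1 := (hv _).1 (h.adj hc)
  have a2 := (h.adj' ha).ne
  have b2 := (h.adj' hb).ne
  have c2 := (h.adj' hc).ne
  have ab := fun e => hab (h.left_injective ha hb e)
  have bc := fun e => hbc (h.left_injective hb hc e)
  have ca := fun e => hca (h.left_injective hc ha e)
  grind

theorem rotate_three (h : IsTriangleSystem G t) {v a b c : V}
    (hv : ∀ w, G.Adj v w ↔ w = a ∨ w = b ∨ w = c) (hab : a ≠ b) (hbc : b ≠ c) (hca : c ≠ a)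
    {x : V} (hx : G.Adj v x) : t (t (t x v) v) v = x := by
  have := h.cyclic_of_degree_three hv hab hbc hca
  rcases (hv x).1 hx with rfl | rfl | rfl <;> grind

end IsTriangleSystem

/-! ### Strong twists and their signs around a vertex of degree three -/

/-- An orientable embedding of the cubic graph dual to a triangle system, in which every face meets
a vertex at most once: `η` tells at which triangles the rotation agrees with that of the triangle
system, and `L` assigns to a dart the face of the embedding to the left of the dual dart. -/
structure IsStrongTwist {V X : Type*} (G : SimpleGraph V) (t : V → V → V) (η : V → V → Bool)
    (L : V → V → X) : Prop where
  sign_eq : ∀ {a b}, G.Adj a b → η b (t a b) = η a b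
  label_true : ∀ {a b}, G.Adj a b → η b a = true → L a (t b a) = L a b
  label_false : ∀ {a b}, G.Adj a b → η b a = false → L (t b a) b = L a b
  label_ne : ∀ {a b}, G.Adj a b → L b (t a b) ≠ L a b

namespace IsStrongTwist

variable {V X : Type*} {G : SimpleGraph V} {t : V → V → V} {η : V → V → Bool} {L : V → V → X}

/-- If one of the three triangles at `v` had the sign opposite to the other two, some face would
enter it from outside, run around `v` through the other two, and cross it again on leaving. Two
sides of that triangle would then carry the same label, against `label_ne`. -/
theorem sign_eq_of_cyclic (hs : IsStrongTwist G t η L) (h : IsTriangleSystem G t) {v a b c : V}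
    (ha : G.Adj v a) (hb : G.Adj v b) (hc : G.Adj v c)
    (hab : t a v = b) (hbc : t b v = c) (hca : t c v = a) : η a v = η b v := by
  have fa1 := h.cyc ha.symm
  have fa2 := h.cyc' ha.symm
  have fb1 := h.cyc hb.symm
  have fb2 := h.cyc' hb.symm
  have fc1 := h.cyc hc.symm
  have fc2 := h.cyc' hc.symm
  have A1 := h.adj' ha.symm
  have A2 := h.adj' hb.symm
  have A3 := h.adj' hc.symm
  have sa1 := hs.sign_eq ha.symm
  have sb1 := hs.sign_eq hb.symm
  have sc1 := hs.sign_eq hc.symm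
  rw [hab] at fa1 fa2 A1 sa1
  rw [hbc] at fb1 fb2 A2 sb1
  rw [hca] at fc1 fc2 A3 sc1
  have na1 := hs.label_ne ha.symm
  have na2 := hs.label_ne hb
  have na3 := hs.label_ne A1
  have nb1 := hs.label_ne hb.symm
  have nb2 := hs.label_ne hc
  have nb3 := hs.label_ne A2
  have nc1 := hs.label_ne hc.symm
  have nc2 := hs.label_ne ha
  have nc3 := hs.label_ne A3
  have ta := hs.label_true ha
  have tb := hs.label_true hb
  have tc := hs.label_true hc
  have ta' := hs.label_true ha.symm
  have tb' := hs.label_true hb.symm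
  have tc' := hs.label_true hc.symm
  have ga := hs.label_false ha
  have gb := hs.label_false hb
  have gc := hs.label_false hc
  have ga' := hs.label_false ha.symm
  have gb' := hs.label_false hb.symm
  have gc' := hs.label_false hc.symm
  simp only [hab, hbc, hca, fa1, fa2, fb1, fb2, fc1, fc2, sa1, sb1, sc1] at *
  generalize η a v = s1 at *
  generalize η b v = s2 at *
  generalize η c v = s3 at *
  cases s1 <;> cases s2 <;> cases s3 <;> grind

/-- The triangles around a vertex of degree three have the same sign. -/
theorem sign_const_of_degree_three (hs : IsStrongTwist G t η L) (h : IsTriangleSystem G t)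
    {v a b c : V} (hv : ∀ w, G.Adj v w ↔ w = a ∨ w = b ∨ w = c)
    (hab : a ≠ b) (hbc : b ≠ c) (hca : c ≠ a) {x y : V} (hx : G.Adj v x) (hy : G.Adj v y) :
    η v x = η v y := by
  have key : η a v = η b v ∧ η b v = η c v := by
    have ha : G.Adj v a := (hv a).2 (by simp)
    have hb : G.Adj v b := (hv b).2 (by simp)
    have hc : G.Adj v c := (hv c).2 (by simp)
    rcases h.cyclic_of_degree_three hv hab hbc hca with ⟨h1, h2, h3⟩ | ⟨h1, h2, h3⟩
    · exact ⟨hs.sign_eq_of_cyclic h ha hb hc h1 h2 h3, hs.sign_eq_of_cyclic h hb hc ha h2 h3 h1⟩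
    · exact ⟨(hs.sign_eq_of_cyclic h hb ha hc h3 h1 h2).symm,
        (hs.sign_eq_of_cyclic h hc hb ha h2 h3 h1).symm⟩
  have key' : ∀ w, G.Adj v w → η w v = η a v := by
    intro w hw
    rcases (hv w).1 hw with rfl | rfl | rfl
    · rfl
    · exact key.1.symm
    · exact (key.1.trans key.2).symm
  have key'' : ∀ w, G.Adj v w → η v w = η a v := by
    intro w hw
    have h1 := hs.sign_eq (h.adj hw)
    rw [h.cyc hw, hs.sign_eq hw] at h1
    rw [← h1]
    exact key' _ (h.adj' hw).symm
  rw [key'' x hx, key'' y hy]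

end IsStrongTwist

/-! ### Deleting a vertex of degree three -/

section Deletion

variable {V : Type u} {G : SimpleGraph V} {a b c : V}

theorem subdivideTriangle_adj_some {x y : V} :
    (subdivideTriangle G a b c).Adj (some x) (some y) ↔ G.Adj x y := Iff.rfl

theorem subdivideTriangle_adj_none (w : Option V) :
    (subdivideTriangle G a b c).Adj none w ↔ w = some a ∨ w = some b ∨ w = some c := by
  cases w with
  | none => simp
  | some w => simp only [Option.some.injEq]; exact Iff.rfl

/-- The triangle system left after deleting the vertex `none` of degree three. -/
def deleteNone (t : Option V → Option V → Option V) (x y : V) : V :=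
  -- If the triangle on `x y` has apex `none`, its neighbour across the side from `y` to `none`
  -- supplies the third corner of the merged triangle. The default `x` is never reached on an edge.
  ((t (some x) (some y)).or (t none (some y))).getD x

theorem deleteNone_of_some {t : Option V → Option V → Option V} {x y z : V}
    (h : t (some x) (some y) = some z) : deleteNone t x y = z := by
  simp [deleteNone, h]

variable {t : Option V → Option V → Option V}

/-- The complete local picture at the deleted vertex: the three triangles there are `x y none`, `y z
none`, `z x none`. The relation `t (some x) none = some z`, which closes the circuit, is where
degree three enters, through `rotate_three`. -/
theorem exists_deleteNone_of_none (hab : a ≠ b) (hbc : b ≠ c) (hca : c ≠ a)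
    (h : IsTriangleSystem (subdivideTriangle G a b c) t) {x y : V} (hxy : G.Adj x y)
    (hn : t (some x) (some y) = none) :
    ∃ z, deleteNone t x y = z ∧ t none (some y) = some z ∧ t (some y) (some z) = none ∧
      t none (some z) = some x ∧ t (some y) none = some x ∧ t (some z) none = some y ∧
      t (some x) none = some z ∧ (subdivideTriangle G a b c).Adj none (some x) ∧
      (subdivideTriangle G a b c).Adj none (some y) ∧
      (subdivideTriangle G a b c).Adj none (some z) ∧ G.Adj y z := by
  have hxy' : (subdivideTriangle G a b c).Adj (some x) (some y) := hxy
  have hy := (h.adj hxy').symm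
  have hx := h.adj' hxy'
  have e1 := h.cyc hxy'
  have e2 := h.cyc' hxy'
  rw [hn] at hx hy e1 e2
  have hz := h.adj' hy
  obtain ⟨z, hz'⟩ : ∃ z, t none (some y) = some z := by
    rcases hh : t none (some y) with _ | z
    · rw [hh] at hz; exact absurd hz (SimpleGraph.irrefl _)
    · exact ⟨z, rfl⟩
  have e3 := h.cyc hy
  have e4 := h.cyc' hy
  have hyz := h.adj hy
  rw [hz'] at e3 e4 hz hyz
  have r := h.rotate_three (v := none) (subdivideTriangle_adj_none (G := G))
    (by simpa using hab) (by simpa using hbc) (by simpa using hca) hz.symm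
  rw [e4, e1] at r
  have e5 := h.cyc hx.symm
  rw [r] at e5
  exact ⟨z, by simp [deleteNone, hn, hz'], hz', e3, e5, e1, e4, r, hx, hy, hz.symm, hyz⟩

theorem IsTriangleSystem.deleteNone (hab : a ≠ b) (hbc : b ≠ c) (hca : c ≠ a)
    (h : IsTriangleSystem (subdivideTriangle G a b c) t) :
    IsTriangleSystem G (deleteNone t) := by
  have key : ∀ {x y}, G.Adj x y →
      G.Adj y (_root_.deleteNone t x y) ∧ _root_.deleteNone t y (_root_.deleteNone t x y) = x := by
    intro x y hxy
    have hxy' : (subdivideTriangle G a b c).Adj (some x) (some y) := hxy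
    rcases hn : t (some x) (some y) with _ | z
    · obtain ⟨z, hz, -, h1, h2, -, -, -, -, -, -, hyz⟩ :=
        exists_deleteNone_of_none hab hbc hca h hxy hn
      rw [hz]
      exact ⟨hyz, by simp [_root_.deleteNone, h1, h2]⟩
    · rw [deleteNone_of_some hn]
      have h1 := h.adj hxy'
      have h2 := h.cyc hxy'
      rw [hn] at h1 h2
      exact ⟨h1, deleteNone_of_some h2⟩
  exact ⟨fun h => (key h).1, fun h => (key h).2⟩

variable {X : Type*} {η : Option V → Option V → Bool} {L : Option V → Option V → X}

/-- The common sign of the three triangles at `none` becomes the sign of the merged triangle. A face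
crossing the merged triangle crosses two of the small ones, turning about the same outer corner in
both, so the old labels still fit. -/
theorem IsStrongTwist.deleteNone (hab : a ≠ b) (hbc : b ≠ c) (hca : c ≠ a)
    (h : IsTriangleSystem (subdivideTriangle G a b c) t)
    (hs : IsStrongTwist (subdivideTriangle G a b c) t η L) :
    IsStrongTwist G (deleteNone t) (fun x y => η (some x) (some y))
      (fun x y => L (some x) (some y)) := by
  have hc : ∀ {x y}, (subdivideTriangle G a b c).Adj none x →
      (subdivideTriangle G a b c).Adj none y → η none x = η none y := fun hx hy =>
    hs.sign_const_of_degree_three h (v := none) (subdivideTriangle_adj_none (G := G))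
      (by simpa using hab) (by simpa using hbc) (by simpa using hca) hx hy
  have hc' : ∀ {x y}, (subdivideTriangle G a b c).Adj none x →
      (subdivideTriangle G a b c).Adj none y → η x none = η none y := fun hx hy => by
    rw [← hs.sign_eq hx.symm]; exact hc (h.adj hx.symm) hy
  constructor
  · intro x y hxy
    have hxy' : (subdivideTriangle G a b c).Adj (some x) (some y) := hxy
    rcases hn : t (some x) (some y) with _ | z
    · obtain ⟨z, hz, h0, h1, h2, h3, h4, h5, hx, hy, hz', hyz⟩ :=
        exists_deleteNone_of_none hab hbc hca h hxy hn
      have e1 := hs.sign_eq hxy'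
      have e2 := hs.sign_eq (subdivideTriangle_adj_some.2 hyz)
      rw [hn, hc' hy hx] at e1
      rw [h1, hc' hz' hx] at e2
      simp only [hz]
      rw [← e1, ← e2]
    · rw [deleteNone_of_some hn, ← hn]
      exact hs.sign_eq hxy'
  · intro x y hxy e
    have hxy' : (subdivideTriangle G a b c).Adj (some x) (some y) := hxy
    rcases hn : t (some y) (some x) with _ | z
    · obtain ⟨z, hz, h0, h1, h2, h3, h4, h5, hy, hx, hz', hyz⟩ :=
        exists_deleteNone_of_none hab hbc hca h hxy.symm hn
      have e1 := hs.sign_eq hxy'.symm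
      rw [hn, e, hc' hx hx] at e1
      have l1 := hs.label_true hxy' e
      have l2 := hs.label_true hx.symm e1
      rw [hn] at l1
      rw [h0] at l2
      rw [hz, l2, l1]
    · rw [deleteNone_of_some hn, ← hn]
      exact hs.label_true hxy' e
  · intro x y hxy e
    have hxy' : (subdivideTriangle G a b c).Adj (some x) (some y) := hxy
    rcases hn : t (some y) (some x) with _ | z
    · obtain ⟨z, hz, h0, h1, h2, h3, h4, h5, hy, hx, hz', hyz⟩ :=
        exists_deleteNone_of_none hab hbc hca h hxy.symm hn
      have e1 := hs.sign_eq hxy'.symm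
      rw [hn, e, hc' hx hx, ← hc' hy hx] at e1
      have l1 := hs.label_false hxy' e
      have l2 := hs.label_false hy e1
      rw [hn] at l1
      rw [h5] at l2
      rw [hz, l2, l1]
    · rw [deleteNone_of_some hn, ← hn]
      exact hs.label_false hxy' e
  · intro x y hxy
    have hxy' : (subdivideTriangle G a b c).Adj (some x) (some y) := hxy
    rcases hn : t (some x) (some y) with _ | z
    · obtain ⟨z, hz, h0, h1, h2, h3, h4, h5, hx, hy, hz', hyz⟩ :=
        exists_deleteNone_of_none hab hbc hca h hxy hn
      rw [hz]
      -- Depending on the sign, one of the two labels is also that of the spoke at `y`, which brings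
      -- both labels to the boundary of a single small triangle.
      rcases e : η none (some y) with _ | _
      · have l1 := hs.label_false hy ((hc' hy hy).trans e)
        have l2 := hs.label_ne hy
        rw [h3] at l1
        rw [h0] at l2
        rwa [l1]
      · have l1 := hs.label_true hy.symm e
        have l2 := hs.label_ne hxy'
        rw [h0] at l1
        rw [hn] at l2
        rwa [l1]
    · rw [deleteNone_of_some hn, ← hn]
      exact hs.label_ne hxy'

end Deletion

/-! ### Rigidity -/

/-- Every strong twist of a triangle system of the graph has a constant sign. -/
def IsTwistRigid {V : Type u} (G : SimpleGraph V) : Prop :=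
  ∀ (X : Type u) (t : V → V → V) (η : V → V → Bool) (L : V → V → X),
    IsTriangleSystem G t → IsStrongTwist G t η L → ∃ s, ∀ x y, G.Adj x y → η x y = s

/-- Each triangle at the new vertex also has a side in `G`, where the sign is already known to be
constant. -/
theorem IsTwistRigid.subdivideTriangle {V : Type u} {G : SimpleGraph V} {a b c : V}
    (hG : IsTwistRigid G) (hab : a ≠ b) (hbc : b ≠ c) (hca : c ≠ a) :
    IsTwistRigid (subdivideTriangle G a b c) := by
  intro X t η L h hs
  obtain ⟨s, hsc⟩ := hG X _ _ _ (h.deleteNone hab hbc hca) (hs.deleteNone hab hbc hca h)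
  have key : ∀ x, (_root_.subdivideTriangle G a b c).Adj none x → η none x = s := by
    intro x hx
    rw [← hs.sign_eq hx]
    have h1 := h.adj hx
    have h2 := h.adj' hx
    rcases x with _ | x
    · exact absurd hx (SimpleGraph.irrefl _)
    rcases hz : t none (some x) with _ | z
    · rw [hz] at h2; exact absurd h2 (SimpleGraph.irrefl _)
    rw [hz] at h1
    exact hsc x z h1
  refine ⟨s, ?_⟩
  rintro (_ | x) (_ | y) hxy
  · exact absurd hxy (SimpleGraph.irrefl _)
  · exact key _ hxy
  · rw [← hs.sign_eq hxy]; exact key _ (h.adj hxy)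
  · exact hsc x y hxy

theorem IsTwistRigid.congr {V W : Type u} {G : SimpleGraph V} {H : SimpleGraph W}
    (hG : IsTwistRigid G) (e : G ≃g H) : IsTwistRigid H := by
  intro X t η L h hs
  have E : ∀ {x y}, G.Adj x y → H.Adj (e x) (e y) := fun h => e.map_adj_iff.2 h
  obtain ⟨s, hsc⟩ := hG X (fun x y => e.symm (t (e x) (e y))) (fun x y => η (e x) (e y))
    (fun x y => L (e x) (e y))
    ⟨fun hab => by
        have := e.symm.map_adj_iff.2 (h.adj (E hab))
        simpa using this,
      fun hab => by simp [h.cyc (E hab)]⟩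
    ⟨fun hab => by simpa using hs.sign_eq (E hab), fun hab => by simpa using hs.label_true (E hab),
      fun hab => by simpa using hs.label_false (E hab),
      fun hab => by simpa using hs.label_ne (E hab)⟩
  refine ⟨s, fun x y hxy => ?_⟩
  simpa using hsc (e.symm x) (e.symm y) (e.symm.map_adj_iff.2 hxy)

/-- The sign is constant around each vertex, and any two vertices lie on a common triangle. -/
theorem isTwistRigid_of_iso_completeFour {V : Type u} {G : SimpleGraph V}
    (e : G ≃g (⊤ : SimpleGraph (Fin 4))) : IsTwistRigid G := by
  have hadj : ∀ x y, G.Adj x y ↔ x ≠ y := fun x y => by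
    rw [← e.map_adj_iff]; simp
  have hF : ∀ i : Fin 4, ∃ a b c : Fin 4, a ≠ b ∧ b ≠ c ∧ c ≠ a ∧
      ∀ w, i ≠ w ↔ w = a ∨ w = b ∨ w = c := by decide
  intro X t η L h hs
  have hc : ∀ {v x y}, G.Adj v x → G.Adj v y → η v x = η v y := by
    intro v x y hx hy
    obtain ⟨a, b, c, hab, hbc, hca, hv⟩ := hF (e v)
    refine hs.sign_const_of_degree_three h (a := e.symm a) (b := e.symm b) (c := e.symm c)
      (fun w => ?_) (by simpa using hab) (by simpa using hbc) (by simpa using hca) hx hy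
    have := hv (e w)
    rw [hadj, ← e.injective.ne_iff, this]
    simp only [RelIso.eq_symm_apply]
  have hc' : ∀ {x y}, G.Adj x y → η y x = η x y := fun hxy =>
    (hc hxy.symm (h.adj hxy)).trans (hs.sign_eq hxy)
  by_cases hV : ∃ x y, G.Adj x y
  · obtain ⟨x, y, hxy⟩ := hV
    refine ⟨η x y, fun z w hzw => ?_⟩
    by_cases hxz : x = z
    · subst hxz; exact hc hzw hxy
    · have hxz' := (hadj x z).2 hxz
      rw [hc hzw hxz'.symm, hc' hxz', hc hxz' hxy]
  · exact ⟨true, fun x y hxy => absurd ⟨x, y, hxy⟩ hV⟩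

/-! ### Edge count and minimum degree of Apollonian networks -/

open Classical in
theorem SimpleGraph.natCard_dart_eq_sum {V : Type*} [Fintype V] (G : SimpleGraph V) :
    Nat.card G.Dart = ∑ x, ∑ y, if G.Adj x y then 1 else 0 := by
  rw [Nat.card_eq_fintype_card, G.dart_card_eq_sum_degrees]
  refine Finset.sum_congr rfl fun x _ => ?_
  rw [← G.card_neighborFinset_eq_degree, G.neighborFinset_eq_filter, Finset.card_filter]

theorem SimpleGraph.natCard_dart {V : Type*} [Finite V] (G : SimpleGraph V) :
    Nat.card G.Dart = 2 * Nat.card G.edgeSet := by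
  classical
  have := Fintype.ofFinite V
  rw [Nat.card_eq_fintype_card, G.dart_card_eq_twice_card_edges, Nat.card_eq_fintype_card,
    ← SimpleGraph.edgeFinset_card]

theorem natCard_dart_subdivideTriangle {V : Type*} [Finite V] (G : SimpleGraph V) {a b c : V}
    (hab : a ≠ b) (hbc : b ≠ c) (hca : c ≠ a) :
    Nat.card (subdivideTriangle G a b c).Dart = Nat.card G.Dart + 6 := by
  classical
  have := Fintype.ofFinite V
  have h3 : (∑ x : V, if x = a ∨ x = b ∨ x = c then 1 else 0) = 3 := by
    rw [← Finset.card_filter]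
    have : (Finset.univ.filter fun x => x = a ∨ x = b ∨ x = c) = {a, b, c} := by ext; simp
    rw [this, Finset.card_eq_three]
    exact ⟨a, b, c, hab, hca.symm, hbc, rfl⟩
  rw [SimpleGraph.natCard_dart_eq_sum, SimpleGraph.natCard_dart_eq_sum]
  have e0 : ∀ x, (subdivideTriangle G a b c).Adj none (some x) ↔ (x = a ∨ x = b ∨ x = c) :=
    fun x => Iff.rfl
  have e1 : ∀ x, (subdivideTriangle G a b c).Adj (some x) none ↔ (x = a ∨ x = b ∨ x = c) :=
    fun x => Iff.rfl
  simp only [Fintype.sum_option, SimpleGraph.irrefl, e0, e1, if_false, h3,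
    subdivideTriangle_adj_some, Finset.sum_add_distrib]
  ring

namespace CellularEmbedding

variable {V : Type u} {G : SimpleGraph V} (M : CellularEmbedding G)

theorem rot_zpow_fst (n : ℤ) (d : G.Dart) : ((M.rot ^ n) d).fst = d.fst := by
  induction n with
  | zero => rfl
  | succ n ih => rw [add_comm, zpow_one_add, Equiv.Perm.mul_apply, M.rot_fst, ih]
  | pred n ih =>
    rw [← ih, ← M.rot_fst, ← Equiv.Perm.mul_apply, ← zpow_one_add]
    congr 4; ring

theorem step_fst (x : Flag G) : (M.step x).1.fst = x.1.snd := by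
  simp [step, rot_zpow_fst]

theorem IsTriangularFace.pairwise_ne {M : CellularEmbedding G} {a b c : V}
    (h : M.IsTriangularFace a b c) : a ≠ b ∧ b ≠ c ∧ c ≠ a := by
  obtain ⟨x, hx⟩ := h
  have hl := congrArg List.length hx
  simp only [facialWalk, List.map_map, List.length_map, List.length_range, List.length_cons,
    List.length_nil] at hl
  have hp : M.step (M.step (M.step x)) = x := by
    have := Function.iterate_minimalPeriod (f := M.step) (x := x)
    rw [hl] at this
    exact this
  rw [facialWalk, hl] at hx
  simp only [zero_add, Nat.reduceAdd, List.range_succ, List.range_zero, List.nil_append,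
    List.cons_append, List.map_cons, List.map_nil, List.cons.injEq, and_true,
    Function.iterate_zero, id, Function.iterate_succ, Function.comp] at hx
  obtain ⟨rfl, rfl, rfl⟩ := hx
  have key : ∀ y : Flag G, y.1.fst ≠ (M.step y).1.fst := fun y => by
    rw [step_fst]; exact y.1.adj.ne
  refine ⟨key _, key _, ?_⟩
  have := key (M.step (M.step x))
  rwa [hp] at this

end CellularEmbedding

theorem isTwistRigid_of_isApollonianNetwork {V : Type u} {G : SimpleGraph V}
    (hG : IsApollonianNetwork G) : IsTwistRigid G := by
  induction hG with
  | completeFour G h => exact isTwistRigid_of_iso_completeFour h.some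
  | subdivide G M a b c _ _ h ih =>
    exact ih.subdivideTriangle h.pairwise_ne.1 h.pairwise_ne.2.1 h.pairwise_ne.2.2
  | iso G H _ h ih => exact ih.congr h.some

theorem IsApollonianNetwork.finite {V : Type u} {G : SimpleGraph V}
    (hG : IsApollonianNetwork G) : Finite V := by
  induction hG with
  | completeFour G h => exact Finite.of_equiv _ h.some.toEquiv.symm
  | subdivide G M a b c _ _ h ih => infer_instance
  | iso G H _ h ih => exact Finite.of_equiv _ h.some.toEquiv

theorem IsApollonianNetwork.natCard_dart {V : Type u} {G : SimpleGraph V}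
    (hG : IsApollonianNetwork G) : Nat.card G.Dart + 12 = 6 * Nat.card V := by
  have hiso : ∀ {V W : Type u} {G : SimpleGraph V} {H : SimpleGraph W} [Finite V], G ≃g H →
      Nat.card H.Dart = Nat.card G.Dart := fun {V W G H} _ e => by
    have := Finite.of_equiv _ e.toEquiv
    rw [SimpleGraph.natCard_dart, SimpleGraph.natCard_dart, Nat.card_congr e.mapEdgeSet]
  induction hG with
  | completeFour G h =>
    have := Finite.of_equiv _ h.some.toEquiv.symm
    have h1 : Nat.card G.edgeSet = 6 := by
      rw [Nat.card_congr h.some.mapEdgeSet, Nat.card_eq_fintype_card, ← SimpleGraph.edgeFinset_card,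
        SimpleGraph.card_edgeFinset_top_eq_card_choose_two]
      decide
    rw [SimpleGraph.natCard_dart, Nat.card_congr h.some.toEquiv, h1]
    simp
  | subdivide G M a b c hG _ h ih =>
    have := hG.finite
    rw [natCard_dart_subdivideTriangle G h.pairwise_ne.1 h.pairwise_ne.2.1 h.pairwise_ne.2.2,
      Finite.card_option]
    omega
  | iso G H hG h ih =>
    have := hG.finite
    rw [hiso h.some, ← Nat.card_congr h.some.toEquiv, ih]

/-- Minimum degree three, in the form that later rules out faces of length two and rotations
exchanging two darts. -/
theorem IsApollonianNetwork.exists_adj {V : Type u} {G : SimpleGraph V}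
    (hG : IsApollonianNetwork G) (v x y : V) : ∃ w, G.Adj v w ∧ w ≠ x ∧ w ≠ y := by
  induction hG with
  | completeFour G h =>
    obtain ⟨e⟩ := h
    have hF : ∀ v x y : Fin 4, ∃ w, v ≠ w ∧ w ≠ x ∧ w ≠ y := by decide
    obtain ⟨w, h1, h2, h3⟩ := hF (e v) (e x) (e y)
    refine ⟨e.symm w, ?_, ?_, ?_⟩
    · rw [← e.map_adj_iff]; simpa using h1
    · rintro rfl; simp at h2
    · rintro rfl; simp at h3
  | subdivide G M a b c hG _ h ih =>
    obtain ⟨h1, h2, h3⟩ := h.pairwise_ne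
    rcases v with _ | v
    · have : ∃ w, (w = a ∨ w = b ∨ w = c) ∧ some w ≠ x ∧ some w ≠ y := by
        by_contra hcon
        push Not at hcon
        have ha := hcon a (by simp)
        have hb := hcon b (by simp)
        have hc := hcon c (by simp)
        by_cases hxa : some a = x
        · subst hxa
          exact h2 (Option.some.inj ((hb (by simpa using h1.symm)).trans
            (hc (by simpa using h3)).symm))
        · obtain rfl := ha hxa
          have hb' : some b = x := by by_contra hh; exact h1 (Option.some.inj (hb hh)).symm
          have hc' : some c = x := by by_contra hh; exact h3 (Option.some.inj (hc hh))
          exact h2 (Option.some.inj (hb'.trans hc'.symm))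
      obtain ⟨w, hw, hx, hy⟩ := this
      exact ⟨some w, hw, hx, hy⟩
    -- When `x` or `y` is `none`, avoiding it is automatic, so the default `v` is harmless.
    · obtain ⟨w, hw, hx, hy⟩ := ih v (x.getD v) (y.getD v)
      refine ⟨some w, hw, ?_, ?_⟩
      · rintro rfl; exact hx rfl
      · rintro rfl; exact hy rfl
  | iso G H hG h ih =>
    obtain ⟨e⟩ := h
    obtain ⟨w, hw, hx, hy⟩ := ih (e.symm v) (e.symm x) (e.symm y)
    refine ⟨e w, ?_, ?_, ?_⟩
    · have := e.map_adj_iff.2 hw; simpa using this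
    · rintro rfl; simp at hx
    · rintro rfl; simp at hy

/-! ### Orientable embeddings: faces as orbits of darts -/

namespace CellularEmbedding

variable {V : Type u} {G : SimpleGraph V} (M : CellularEmbedding G) (ε : V → ℤˣ)

/-- The rotation system after reversing the rotations at the vertices where `ε` is `-1`. -/
def orientedRot : Equiv.Perm G.Dart where
  toFun d := (M.rot ^ (ε d.fst : ℤ)) d
  invFun d := (M.rot ^ (-(ε d.fst : ℤ))) d
  left_inv d := by simp [rot_zpow_fst]
  right_inv d := by
    dsimp only
    rw [rot_zpow_fst, ← Equiv.Perm.mul_apply, ← zpow_add, add_neg_cancel, zpow_zero]; rfl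

theorem orientedRot_apply (d : G.Dart) : M.orientedRot ε d = (M.rot ^ (ε d.fst : ℤ)) d := rfl

theorem orientedRot_fst (d : G.Dart) : (M.orientedRot ε d).fst = d.fst := M.rot_zpow_fst _ _

theorem sameCycle_orientedRot_rot (d : G.Dart) : (M.orientedRot ε).SameCycle d (M.rot d) := by
  rcases Int.units_eq_one_or (ε d.fst) with h | h
  · refine ⟨1, ?_⟩
    simp [orientedRot_apply, h]
  · refine ⟨-1, ?_⟩
    rw [zpow_neg_one, Equiv.Perm.inv_eq_iff_eq]
    simp [orientedRot_apply, M.rot_fst, h]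

theorem orientedRot_sameCycle {d d' : G.Dart} (h : d.fst = d'.fst) :
    (M.orientedRot ε).SameCycle d d' := by
  obtain ⟨n, rfl⟩ := M.rot_sameCycle d d' h
  clear h
  induction n with
  | zero => exact Equiv.Perm.SameCycle.refl _ _
  | succ n ih =>
    refine ih.trans ?_
    rw [add_comm, zpow_one_add, Equiv.Perm.mul_apply]
    exact M.sameCycle_orientedRot_rot ε _
  | pred n ih =>
    refine ih.trans (Equiv.Perm.SameCycle.symm ?_)
    have := M.sameCycle_orientedRot_rot ε ((M.rot ^ (-(n : ℤ) - 1)) d)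
    rwa [← Equiv.Perm.mul_apply, ← zpow_one_add, add_sub_cancel] at this

/-- If two darts at a vertex are exchanged by the rotation, there are no others. -/
theorem eq_or_eq_of_orientedRot {d₁ d₂ d : G.Dart} (h₁ : M.orientedRot ε d₁ = d₂)
    (h₂ : M.orientedRot ε d₂ = d₁) (h : d₁.fst = d.fst) : d = d₁ ∨ d = d₂ := by
  obtain ⟨n, rfl⟩ := M.orientedRot_sameCycle ε h
  clear h
  induction n with
  | zero => exact Or.inl rfl
  | succ n ih =>
    rw [add_comm, zpow_one_add, Equiv.Perm.mul_apply]
    rcases ih with ih | ih <;> rw [ih] <;> simp [h₁, h₂]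
  | pred n ih =>
    rw [sub_eq_add_neg, add_comm, zpow_add, zpow_neg_one, Equiv.Perm.mul_apply,
      Equiv.Perm.inv_eq_iff_eq, Equiv.Perm.inv_eq_iff_eq, h₁, h₂]
    exact ih.symm

/-- The face traversal in an oriented embedding, on darts. -/
def faceSucc : Equiv.Perm G.Dart :=
  (SimpleGraph.Dart.symm_involutive (G := G)).toPerm.trans (M.orientedRot ε)

theorem faceSucc_apply (d : G.Dart) : M.faceSucc ε d = M.orientedRot ε d.symm := rfl

theorem faceSucc_fst (d : G.Dart) : (M.faceSucc ε d).fst = d.snd := M.orientedRot_fst ε _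

/-- The face to the left of a dart in an oriented embedding. -/
def leftFace (d : G.Dart) : M.Face := M.face (d, ε d.fst)

variable {M ε} (hε : ∀ d : G.Dart, M.dartSign d = ε d.fst * ε d.snd)
include hε

theorem step_leftFlag (d : G.Dart) :
    M.step (d, ε d.fst) = (M.faceSucc ε d, ε (M.faceSucc ε d).fst) := by
  have h : ε d.fst * M.dartSign d = ε d.snd := by
    rw [hε, ← mul_assoc, Int.units_mul_self, one_mul]
  rw [faceSucc_fst]
  simp [step, h, faceSucc_apply, orientedRot_apply]

theorem step_iterate_leftFlag (n : ℕ) (d : G.Dart) :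
    M.step^[n] (d, ε d.fst) =
      ((M.faceSucc ε)^[n] d, ε ((M.faceSucc ε)^[n] d).fst) := by
  induction n generalizing d with
  | zero => rfl
  | succ n ih => rw [Function.iterate_succ_apply, step_leftFlag hε, ih, Function.iterate_succ_apply]

theorem leftFace_faceSucc (d : G.Dart) :
    M.leftFace ε (M.faceSucc ε d) = M.leftFace ε d := by
  unfold leftFace
  rw [← step_leftFlag hε d]
  exact Eq.symm (Quot.sound (r := fun x y : Flag G => y = M.step x ∨ y = M.reverse x) (Or.inl rfl))

theorem face_eq_leftFace (x : Flag G) :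
    M.face x = M.leftFace ε x.1 ∨ M.face x = M.leftFace ε x.1.symm := by
  obtain ⟨d, s⟩ := x
  by_cases h : s = ε d.fst
  · left; rw [h]; rfl
  · right
    refine Quot.sound (Or.inr ?_)
    have h' : s = -ε d.fst := by
      rcases Int.units_eq_one_or s with rfl | rfl <;>
      rcases Int.units_eq_one_or (ε d.fst) with h1 | h1 <;> simp_all
    simp only [reverse, hε, h', Prod.mk.injEq, true_and]
    rw [neg_mul, neg_neg, ← mul_assoc, Int.units_mul_self, one_mul]
    rfl

theorem leftFace_surjective : Function.Surjective (M.leftFace ε) := by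
  rintro ⟨x⟩
  rcases face_eq_leftFace hε x with h | h
  · exact ⟨_, h.symm⟩
  · exact ⟨_, h.symm⟩

open Classical in
/-- A function on darts that is invariant under the face traversal descends to the faces. -/
theorem exists_face_lift {X : Type*} (g : G.Dart → X) (hg : ∀ d, g (M.faceSucc ε d) = g d) :
    ∃ f : M.Face → X, ∀ d, f (M.leftFace ε d) = g d := by
  refine ⟨Quot.lift (fun x : Flag G => if x.2 = ε x.1.fst then g x.1 else g x.1.symm) ?_, ?_⟩
  · rintro ⟨d, s⟩ y hy
    have hs : s = ε d.fst ∨ s = -ε d.fst := by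
      rcases Int.units_eq_one_or s with rfl | rfl <;>
      rcases Int.units_eq_one_or (ε d.fst) with h1 | h1 <;> simp_all
    have hne : ∀ u : ℤˣ, ¬ -u = u := fun u => by
      rcases Int.units_eq_one_or u with rfl | rfl <;> decide
    rcases hs with rfl | rfl
    · rcases hy with rfl | rfl
      · rw [step_leftFlag hε]; simp [hg]
      · have h : ε d.fst * M.dartSign d = ε d.snd := by
          rw [hε, ← mul_assoc, Int.units_mul_self, one_mul]
        simp [reverse, h, hne]
    · have h : -ε d.fst * M.dartSign d = -ε d.snd := by
        rw [hε, neg_mul, ← mul_assoc, Int.units_mul_self, one_mul]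
      rcases hy with rfl | rfl
      -- A flag read against the orientation traverses the same face backwards, so its step inverts
      -- `faceSucc` on reversed darts.
      · have h2 : M.faceSucc ε ((M.rot ^ ((-ε d.snd : ℤˣ) : ℤ)) d.symm).symm = d.symm := by
          rw [faceSucc_apply, SimpleGraph.Dart.symm_symm, orientedRot_apply, rot_zpow_fst,
            ← Equiv.Perm.mul_apply, ← zpow_add]
          simp
        have h3 := hg ((M.rot ^ ((-ε d.snd : ℤˣ) : ℤ)) d.symm).symm
        rw [h2] at h3
        simp only [step, h, hne, if_false, rot_zpow_fst]
        rw [if_neg (show ¬ -ε d.snd = ε d.symm.fst from hne _), h3]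
      · simp [reverse, h, hne]
  · intro d
    simp [leftFace, face]

/-- In a strong embedding the corners of a face lie at different vertices. -/
theorem IsStrong.eq_of_leftFace_eq [Finite V] (hM : M.IsStrong) {d d' : G.Dart}
    (h : M.leftFace ε d = M.leftFace ε d') (hfst : d.fst = d'.fst) : d = d' := by
  have : Finite G.Dart := Finite.of_injective _ SimpleGraph.Dart.toProd_injective
  obtain ⟨f, hf⟩ := exists_face_lift hε
    (fun d => Quotient.mk (Equiv.Perm.SameCycle.setoid (M.faceSucc ε)) d)
    (fun d => Quotient.sound (Equiv.Perm.sameCycle_apply_left.2 (Equiv.Perm.SameCycle.refl _ _)))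
  have hc : (M.faceSucc ε).SameCycle d d' := by
    have := hf d
    rw [h, hf d'] at this
    exact Quotient.exact this.symm
  -- A cycle has distinct heads of darts, whereas the hypothesis concerns tails; hence the shift
  -- back by one dart.
  set e := (M.faceSucc ε).symm d with he
  have hd : M.faceSucc ε e = d := Equiv.apply_symm_apply _ _
  set e' := (M.faceSucc ε).symm d' with he'
  have hd' : M.faceSucc ε e' = d' := Equiv.apply_symm_apply _ _
  have hc' : (M.faceSucc ε).SameCycle e e' := by
    rw [← hd, ← hd'] at hc
    simpa using hc
  obtain ⟨n, hn⟩ := hc'.exists_nat_pow_eq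
  obtain ⟨v, c, hcyc, hw⟩ := hM (e, ε e.fst)
  have hmem : ∀ n : ℕ, (M.faceSucc ε)^[n] e ∈ c.darts := by
    intro n
    rw [hw, facialWalk, List.mem_map]
    have hpos : 0 < Function.minimalPeriod M.step (e, ε e.fst) := by
      have h0 : 0 < c.darts.length := by
        rw [SimpleGraph.Walk.length_darts]; have := hcyc.three_le_length; omega
      rw [hw] at h0
      simpa [facialWalk] using h0
    refine ⟨n % Function.minimalPeriod M.step (e, ε e.fst),
      List.mem_range.2 (Nat.mod_lt _ hpos), ?_⟩
    rw [Function.iterate_mod_minimalPeriod_eq, step_iterate_leftFlag hε]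
  have h1 : e ∈ c.darts := hmem 0
  have h2 : e' ∈ c.darts := by
    have := hmem n
    rwa [← Equiv.Perm.coe_pow, hn] at this
  have hnd : (c.darts.map (·.snd)).Nodup := by
    rw [SimpleGraph.Walk.map_snd_darts]; exact hcyc.support_nodup
  have := List.inj_on_of_nodup_map hnd h1 h2
    (by rw [← M.faceSucc_fst ε, ← M.faceSucc_fst ε, hd, hd', hfst])
  rw [← hd, ← hd', this]

end CellularEmbedding

/-! ### Spherical triangulations and their dual graphs -/

namespace CellularEmbedding

variable {V : Type u} {G : SimpleGraph V} {M : CellularEmbedding G} {ε : V → ℤˣ}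

theorem faceSucc_ne (d : G.Dart) : M.faceSucc ε d ≠ d := fun h => by
  have := M.faceSucc_fst ε d
  rw [h] at this
  exact d.adj.ne this

variable (hdeg : ∀ v x y, ∃ w, G.Adj v w ∧ w ≠ x ∧ w ≠ y)
include hdeg

theorem not_orientedRot_swap {d₁ d₂ : G.Dart} (h₁ : M.orientedRot ε d₁ = d₂)
    (h₂ : M.orientedRot ε d₂ = d₁) : False := by
  obtain ⟨w, hw, h1, h2⟩ := hdeg d₁.fst d₁.snd d₂.snd
  rcases M.eq_or_eq_of_orientedRot ε (d := ⟨(d₁.fst, w), hw⟩) h₁ h₂ rfl with h | h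
  · exact h1 (congrArg (·.snd) h)
  · exact h2 (congrArg (·.snd) h)

theorem faceSucc_ne_symm (d : G.Dart) : M.faceSucc ε d ≠ d.symm := fun h =>
  not_orientedRot_swap hdeg h h

theorem faceSucc_snd_ne (d : G.Dart) : (M.faceSucc ε d).snd ≠ d.fst := fun h =>
  faceSucc_ne_symm hdeg d (SimpleGraph.Dart.ext _ _ (Prod.ext (M.faceSucc_fst ε d) h))

theorem faceSucc_faceSucc_ne (d : G.Dart) : M.faceSucc ε (M.faceSucc ε d) ≠ d := fun h => by
  refine faceSucc_snd_ne (M := M) (ε := ε) hdeg d ?_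
  rw [← M.faceSucc_fst ε, h]

variable [Finite V] (hε : ∀ d : G.Dart, M.dartSign d = ε d.fst * ε d.snd)
  (hcard : Nat.card G.Dart = 3 * Nat.card M.Face)
include hε hcard

/-- If the number of edges is as large as possible, all faces are triangles. -/
theorem eq_of_leftFace_eq_of_card {d d' : G.Dart} (h : M.leftFace ε d' = M.leftFace ε d) :
    d' = d ∨ d' = M.faceSucc ε d ∨ d' = M.faceSucc ε (M.faceSucc ε d) := by
  classical
  have : Finite G.Dart := Finite.of_injective _ SimpleGraph.Dart.toProd_injective
  have : Finite M.Face := Finite.of_surjective _ (leftFace_surjective hε)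
  have := Fintype.ofFinite G.Dart
  have := Fintype.ofFinite M.Face
  have hsub : ∀ d : G.Dart, {d, M.faceSucc ε d, M.faceSucc ε (M.faceSucc ε d)} ⊆
      Finset.univ.filter (fun d' => M.leftFace ε d' = M.leftFace ε d) := by
    intro d
    simp [Finset.insert_subset_iff, leftFace_faceSucc hε]
  have hthree : ∀ d : G.Dart,
      ({d, M.faceSucc ε d, M.faceSucc ε (M.faceSucc ε d)} : Finset G.Dart).card = 3 :=
    fun d => Finset.card_eq_three.2 ⟨_, _, _, (faceSucc_ne d).symm,
      (faceSucc_faceSucc_ne hdeg d).symm, (faceSucc_ne _).symm, rfl⟩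
  -- Every face has at least three darts, and by `hcard` the average is three, so equality holds for
  -- each face.
  have hle : ∀ f ∈ (Finset.univ : Finset M.Face),
      3 ≤ (Finset.univ.filter (fun d' => M.leftFace ε d' = f)).card := by
    intro f _
    obtain ⟨d, rfl⟩ := leftFace_surjective hε f
    rw [← hthree d]
    exact Finset.card_le_card (hsub d)
  have hsum : ∑ _f : M.Face, 3 =
      ∑ f : M.Face, (Finset.univ.filter (fun d' => M.leftFace ε d' = f)).card := by
    rw [← Finset.card_eq_sum_card_fiberwise (f := M.leftFace ε) (s := Finset.univ)
      (fun _ _ => Finset.mem_coe.2 (Finset.mem_univ _))]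
    simp only [Nat.card_eq_fintype_card] at hcard
    simp [hcard, mul_comm]
  have heq := (Finset.sum_eq_sum_iff_of_le hle).1 hsum (M.leftFace ε d) (Finset.mem_univ _)
  have := Finset.eq_of_subset_of_card_le (hsub d) (by rw [hthree, ← heq])
  have hd : d' ∈ Finset.univ.filter (fun d' => M.leftFace ε d' = M.leftFace ε d) := by simp [h]
  rw [← this] at hd
  simpa using hd

theorem faceSucc_three (d : G.Dart) : M.faceSucc ε (M.faceSucc ε (M.faceSucc ε d)) = d := by
  rcases eq_of_leftFace_eq_of_card hdeg hε hcard
    (d := d) (d' := M.faceSucc ε (M.faceSucc ε (M.faceSucc ε d)))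
    (by simp only [leftFace_faceSucc hε]) with h | h | h
  · exact h
  · exact absurd ((M.faceSucc ε).injective h) (faceSucc_faceSucc_ne hdeg d)
  · exact absurd ((M.faceSucc ε).injective ((M.faceSucc ε).injective h)) (faceSucc_ne d)

theorem faceSucc_faceSucc_snd (d : G.Dart) : (M.faceSucc ε (M.faceSucc ε d)).snd = d.fst := by
  rw [← M.faceSucc_fst ε, faceSucc_three hdeg hε hcard]

theorem leftFace_ne_symm (d : G.Dart) : M.leftFace ε d ≠ M.leftFace ε d.symm := by
  intro h
  rcases eq_of_leftFace_eq_of_card hdeg hε hcard h.symm with h | h | h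
  · exact d.symm_ne h
  · exact faceSucc_ne_symm hdeg d h.symm
  · have h' := congrArg (M.faceSucc ε) h
    rw [faceSucc_three hdeg hε hcard] at h'
    exact faceSucc_ne_symm (M := M) (ε := ε) hdeg d.symm (by rw [h', d.symm_symm])

/-- If two consecutive sides of a triangle bordered the same second triangle, their common vertex
would have degree two. This excludes parallel edges in the dual, which `dual` as a simple graph
would silently merge. -/
theorem leftFace_symm_ne_faceSucc (d : G.Dart) :
    M.leftFace ε (M.faceSucc ε d).symm ≠ M.leftFace ε d.symm := by
  intro h
  rcases eq_of_leftFace_eq_of_card hdeg hε hcard h with h | h | h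
  · exact faceSucc_ne d (SimpleGraph.Dart.symm_involutive.injective h)
  · refine faceSucc_snd_ne (M := M) (ε := ε) hdeg d ?_
    have := congrArg (·.fst) h
    rwa [M.faceSucc_fst] at this
  · have h' := congrArg (M.faceSucc ε) h
    rw [faceSucc_three hdeg hε hcard, faceSucc_apply _ _ (SimpleGraph.Dart.symm _),
      SimpleGraph.Dart.symm_symm] at h'
    exact not_orientedRot_swap (M := M) (ε := ε) (d₁ := d.symm) (h₂ := h') (h₁ := rfl) hdeg

/-- A dart is determined by the faces on its two sides. -/
theorem eq_of_leftFace_eq_of_leftFace_symm_eq {d d' : G.Dart}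
    (h : M.leftFace ε d' = M.leftFace ε d) (h' : M.leftFace ε d'.symm = M.leftFace ε d.symm) :
    d' = d := by
  rcases eq_of_leftFace_eq_of_card hdeg hε hcard h with e | e | e
  · exact e
  · rw [e] at h'
    exact absurd h' (leftFace_symm_ne_faceSucc hdeg hε hcard d)
  · have e' := congrArg (M.faceSucc ε) e
    rw [faceSucc_three hdeg hε hcard] at e'
    rw [← e'] at h'
    exact leftFace_symm_ne_faceSucc hdeg hε hcard _ h'.symm |>.elim

/-- The darts of a graph isomorphic to the dual correspond to those of the graph. -/
theorem exists_dual_dart {W : Type u} {D : SimpleGraph W} (e : D ≃g M.dual) :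
    ∃ j : G.Dart ≃ D.Dart, (∀ d, j d.symm = (j d).symm) ∧
      ∀ d d', (j d).fst = (j d').fst ↔ M.leftFace ε d = M.leftFace ε d' := by
  have hadj : ∀ d : G.Dart, D.Adj (e.symm (M.leftFace ε d)) (e.symm (M.leftFace ε d.symm)) :=
    fun d => e.symm.map_adj_iff.2 ⟨leftFace_ne_symm hdeg hε hcard d, _, _, rfl, rfl,
      d.edge_symm.symm⟩
  let j : G.Dart → D.Dart := fun d => ⟨(_, _), hadj d⟩
  have hinj : Function.Injective j := by
    intro d d' h
    have h1 : e.symm (M.leftFace ε d) = e.symm (M.leftFace ε d') := congrArg (·.fst) h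
    have h2 : e.symm (M.leftFace ε d.symm) = e.symm (M.leftFace ε d'.symm) := congrArg (·.snd) h
    exact eq_of_leftFace_eq_of_leftFace_symm_eq hdeg hε hcard (e.symm.injective h1)
      (e.symm.injective h2)
  have hsurj : Function.Surjective j := by
    intro x
    obtain ⟨hne, y, z, hy, hz, hyz⟩ := e.map_adj_iff.2 x.adj
    have key : ∃ d, M.leftFace ε d = e x.fst ∧ M.leftFace ε d.symm = e x.snd := by
      have hz' : z.1 = y.1 ∨ z.1 = y.1.symm := (SimpleGraph.dart_edge_eq_iff _ _).1 hyz.symm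
      rcases face_eq_leftFace hε y with h1 | h1 <;> rcases face_eq_leftFace hε z with h2 | h2 <;>
        rcases hz' with h3 | h3 <;>
        simp only [h3, SimpleGraph.Dart.symm_symm] at h2 <;> rw [hy] at h1 <;> rw [hz] at h2 <;>
        first
        | exact absurd (h1.trans h2.symm) hne
        | exact ⟨_, h1.symm, h2.symm⟩
    obtain ⟨d, h1, h2⟩ := key
    refine ⟨d, SimpleGraph.Dart.ext _ _ (Prod.ext ?_ ?_)⟩
    · simp [j, h1]
    · simp [j, h2]
  refine ⟨Equiv.ofBijective j ⟨hinj, hsurj⟩, fun d => ?_, fun d d' => ?_⟩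
  · refine SimpleGraph.Dart.ext _ _ (Prod.ext rfl ?_)
    change e.symm (M.leftFace ε d.symm.symm) = e.symm (M.leftFace ε d)
    rw [d.symm_symm]
  · exact e.symm.injective.eq_iff

end CellularEmbedding

/-! ### Embeddings of the dual graph compared with the spherical one -/

namespace CellularEmbedding

variable {V W : Type u} {G : SimpleGraph V} {M : CellularEmbedding G} {ε : V → ℤˣ}
  {D : SimpleGraph W} {N : CellularEmbedding D} {δ : W → ℤˣ} [Finite V]
  (hdeg : ∀ v x y, ∃ w, G.Adj v w ∧ w ≠ x ∧ w ≠ y)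
  (hε : ∀ d : G.Dart, M.dartSign d = ε d.fst * ε d.snd)
  (hcard : Nat.card G.Dart = 3 * Nat.card M.Face)
  (j : G.Dart ≃ D.Dart) (hj : ∀ d, j d.symm = (j d).symm)
  (hjf : ∀ d d', (j d).fst = (j d').fst ↔ M.leftFace ε d = M.leftFace ε d')
include hdeg hε hcard hjf

/-- The darts of `D` at a vertex are the three sides of a triangle, and a rotation that is a single
cycle on them fixes none. -/
theorem orientedRot_dual (d : G.Dart) :
    N.orientedRot δ (j d) = j (M.faceSucc ε d) ∨
      N.orientedRot δ (j d) = j (M.faceSucc ε (M.faceSucc ε d)) := by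
  obtain ⟨d', hd'⟩ := j.surjective (N.orientedRot δ (j d))
  have h := N.orientedRot_fst δ (j d)
  rw [← hd', hjf] at h
  rcases eq_of_leftFace_eq_of_card hdeg hε hcard h with e | e | e
  · have h1 : N.orientedRot δ (j d) = j d := by rw [← hd', e]
    have h2 : (j d).fst = (j (M.faceSucc ε d)).fst := by rw [hjf, leftFace_faceSucc hε]
    rcases N.eq_or_eq_of_orientedRot δ h1 h1 h2 with h3 | h3 <;>
      exact absurd (j.injective h3) (faceSucc_ne d)
  · left; rw [← hd', e]
  · right; rw [← hd', e]

theorem orientedRot_dual_faceSucc {d : G.Dart} (h : N.orientedRot δ (j d) = j (M.faceSucc ε d)) :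
    N.orientedRot δ (j (M.faceSucc ε d)) = j (M.faceSucc ε (M.faceSucc ε d)) := by
  rcases orientedRot_dual (N := N) (δ := δ) hdeg hε hcard j hjf (M.faceSucc ε d) with h' | h'
  · exact h'
  · rw [faceSucc_three hdeg hε hcard] at h'
    have h2 : (j d).fst = (j (M.faceSucc ε (M.faceSucc ε d))).fst := by
      rw [hjf, leftFace_faceSucc hε, leftFace_faceSucc hε]
    rcases N.eq_or_eq_of_orientedRot δ h h' h2 with h3 | h3
    · exact absurd (j.injective h3) (faceSucc_faceSucc_ne hdeg d)
    · exact absurd (j.injective h3) (faceSucc_ne _)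

theorem orientedRot_dual_faceSucc_iff (d : G.Dart) :
    N.orientedRot δ (j (M.faceSucc ε d)) = j (M.faceSucc ε (M.faceSucc ε d)) ↔
      N.orientedRot δ (j d) = j (M.faceSucc ε d) := by
  have key := fun d => orientedRot_dual_faceSucc (N := N) (δ := δ) hdeg hε hcard j hjf (d := d)
  refine ⟨fun h => ?_, key d⟩
  have := key _ (key _ h)
  rwa [faceSucc_three hdeg hε hcard] at this

variable [Finite W] (hδ : ∀ x : D.Dart, N.dartSign x = δ x.fst * δ x.snd)
include hj hδ

/-- A strong orientable embedding of the dual is, locally at each face, either the spherical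
embedding or its mirror image; rigidity makes this choice uniform. -/
theorem IsStrong.orientedRot_uniform (hN : N.IsStrong) (hG : IsTwistRigid G) :
    ∃ s : Bool, ∀ d, N.orientedRot δ (j d) = j (M.faceSucc ε d) ↔ s = true := by
  classical
  let t : V → V → V := fun a b => if h : G.Adj a b then (M.faceSucc ε ⟨(a, b), h⟩).snd else a
  let η : V → V → Bool := fun a b => if h : G.Adj a b then
    decide (N.orientedRot δ (j ⟨(a, b), h⟩) = j (M.faceSucc ε ⟨(a, b), h⟩)) else true
  let L : V → V → Option N.Face := fun a b => if h : G.Adj a b then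
    some (N.leftFace δ (j ⟨(a, b), h⟩)) else none
  have ht : ∀ d : G.Dart, t d.fst d.snd = (M.faceSucc ε d).snd := fun d => dif_pos d.adj
  have hη : ∀ d : G.Dart, η d.fst d.snd =
      decide (N.orientedRot δ (j d) = j (M.faceSucc ε d)) := fun d => dif_pos d.adj
  have hL : ∀ d : G.Dart, L d.fst d.snd = some (N.leftFace δ (j d)) := fun d => dif_pos d.adj
  have hf := M.faceSucc_fst ε
  have hff : ∀ d, (M.faceSucc ε (M.faceSucc ε d)).fst = (M.faceSucc ε d).snd := fun d => hf _
  have hsnd := faceSucc_faceSucc_snd (M := M) (ε := ε) hdeg hε hcard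
  have hlab : ∀ d : G.Dart, N.leftFace δ (N.orientedRot δ (j d.symm)) = N.leftFace δ (j d) :=
    fun d => by
      rw [hj, ← faceSucc_apply, leftFace_faceSucc hδ]
  obtain ⟨s, hs⟩ := hG _ t η L
    ⟨fun {a b} hab => by
        have := (M.faceSucc ε ⟨(a, b), hab⟩).adj
        rwa [hf, ← ht] at this,
      fun {a b} hab => by
        have := ht (M.faceSucc ε ⟨(a, b), hab⟩)
        rwa [hf, ← ht, hsnd] at this⟩
    ⟨fun {a b} hab => by
        have := hη (M.faceSucc ε ⟨(a, b), hab⟩)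
        rw [hf, ← ht, decide_eq_decide.2 (orientedRot_dual_faceSucc_iff hdeg hε hcard j hjf _),
          ← hη] at this
        exact this,
      fun {a b} hab h => by
        have h1 := hη (⟨(a, b), hab⟩ : G.Dart).symm
        have h1' := of_decide_eq_true (h1.symm.trans h)
        have h2 := hL (M.faceSucc ε (⟨(a, b), hab⟩ : G.Dart).symm)
        rw [← h1', hlab, hf, ← ht, ← hL] at h2
        exact h2,
      fun {a b} hab h => by
        have h1 := hη (⟨(a, b), hab⟩ : G.Dart).symm
        have h1' := of_decide_eq_false (h1.symm.trans h)
        have h1'' := (orientedRot_dual hdeg hε hcard j hjf _).resolve_left h1'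
        have h2 := hL (M.faceSucc ε (M.faceSucc ε (⟨(a, b), hab⟩ : G.Dart).symm))
        rw [← h1'', hlab, hff, ← ht, hsnd, ← hL] at h2
        exact h2,
      -- Strength enters here: distinct darts leaving the same vertex of `D` have distinct left
      -- faces.
      fun {a b} hab h => by
        have h2 := hL (M.faceSucc ε ⟨(a, b), hab⟩)
        have h3 := hL ⟨(a, b), hab⟩
        rw [hf, ← ht] at h2
        have h4 := h2.symm.trans (h.trans h3)
        have h5 := hN.eq_of_leftFace_eq hδ (Option.some.inj h4)
          ((hjf _ _).2 (leftFace_faceSucc hε _))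
        exact faceSucc_ne _ (j.injective h5)⟩
  refine ⟨s, fun d => ?_⟩
  have := hs _ _ d.adj
  rw [hη] at this
  rw [← this, decide_eq_true_iff]

/-- With a uniform sign, a face of `N` runs around one vertex of `G`: the tail of the corresponding
darts of `G` stays fixed if the rotations agree, the head if they are mirrored. This maps the faces
of `N` onto the vertices of `G`. -/
theorem IsStrong.natCard_le_face (hN : N.IsStrong) (hG : IsTwistRigid G) :
    Nat.card V ≤ Nat.card N.Face := by
  have : Finite D.Dart := Finite.of_injective _ SimpleGraph.Dart.toProd_injective
  have : Finite N.Face := Finite.of_surjective _ (leftFace_surjective hδ)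
  suffices ∃ g : D.Dart → V, Function.Surjective g ∧ ∀ x, g (N.faceSucc δ x) = g x by
    obtain ⟨g, hg, hgi⟩ := this
    obtain ⟨f, hf⟩ := exists_face_lift hδ g hgi
    refine Nat.card_le_card_of_surjective f fun v => ?_
    obtain ⟨x, rfl⟩ := hg v
    exact ⟨_, hf x⟩
  obtain ⟨s, hs⟩ := hN.orientedRot_uniform hdeg hε hcard j hj hjf hδ hG
  have hx : ∀ x, N.faceSucc δ x = N.orientedRot δ (j (j.symm x).symm) := fun x => by
    rw [hj, j.apply_symm_apply, faceSucc_apply]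
  cases s with
  | true =>
    refine ⟨fun x => (j.symm x).fst, fun v => ?_, fun x => ?_⟩
    · obtain ⟨w, hw, -⟩ := hdeg v v v
      exact ⟨j ⟨(v, w), hw⟩, by simp⟩
    · dsimp only
      rw [hx, (hs _).2 rfl, j.symm_apply_apply, faceSucc_fst]
      rfl
  | false =>
    refine ⟨fun x => (j.symm x).snd, fun v => ?_, fun x => ?_⟩
    · obtain ⟨w, hw, -⟩ := hdeg v v v
      exact ⟨j ⟨(w, v), hw.symm⟩, by simp⟩
    · dsimp only
      rw [hx, (orientedRot_dual hdeg hε hcard j hjf _).resolve_left (by rw [hs]; simp),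
        j.symm_apply_apply, faceSucc_faceSucc_snd hdeg hε hcard]
      rfl

end CellularEmbedding

/-! ### Conclusion by Euler characteristic -/

theorem mainTheorem2 {W : Type u} (D : SimpleGraph W) (hD : IsApollonianDual D) :
    ¬ ∃ (g : ℕ) (M : CellularEmbedding D),
        0 < g ∧ M.OnOrientableSurface g ∧ M.IsStrong := by
  rintro ⟨g, N, hg, ⟨⟨δ, hδ⟩, hχ⟩, hN⟩
  obtain ⟨V, T, M, hT, ⟨⟨ε, hε⟩, hχM⟩, ⟨e⟩⟩ := hD
  have := hT.finite
  have hdeg := hT.exists_adj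
  have hdart := hT.natCard_dart
  have hedge := T.natCard_dart
  have hfin : Finite T.Dart := Finite.of_injective _ SimpleGraph.Dart.toProd_injective
  have : Finite M.Face := Finite.of_surjective _ (CellularEmbedding.leftFace_surjective hε)
  have : Finite W := Finite.of_equiv _ e.toEquiv.symm
  -- From `V - E + F = 2` and `2E + 12 = 6V` follows `2E = 3F`.
  have hcard : Nat.card T.Dart = 3 * Nat.card M.Face := by
    unfold CellularEmbedding.eulerChar at hχM
    push_cast at hχM
    omega
  obtain ⟨j, hj, hjf⟩ := CellularEmbedding.exists_dual_dart hdeg hε hcard e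
  have hle := hN.natCard_le_face hdeg hε hcard j hj hjf hδ (isTwistRigid_of_isApollonianNetwork hT)
  have hW := Nat.card_congr e.toEquiv
  have hDart := Nat.card_congr j
  have hDedge := D.natCard_dart
  unfold CellularEmbedding.eulerChar at hχ
  -- Vertices of `D` are faces of `M`, and `N` has at least `|V|` faces, so the characteristic of
  -- `N` is at least that of the sphere, while `g > 0` makes it at most 0.
  omega
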